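/- Let $1<r<\infty$. There is a constant $C'_r\in\mathbb R$, depending only on $r$, namely the smallest constant $C$ for which every space $L^r(\Omega,\mathscr A,\mu)$ of real functions on a measure space has type $\min(2,r)$ with constant $C$, i.e. $$\mathbb E_{\varepsilon}\Big\|\sum_{j=1}^n\varepsilon_jf_j\Big\|_{L^r(\mu)}\le C\Big(\sum_{j=1}^n\|f_j\|_{L^r(\mu)}^{\min(2,r)}\Big)^{1/\min(2,r)}$$ for all measure spaces $(\Omega,\mathscr A,\mu)$, all $n$ and all $f_1,\dots,f_n\in L^r(\mu)$, where $\varepsilon_1,\dots,\varepsilon_n$ are independent uniform random signs (such a smallest constant exists and is finite), with the following property. Let $d\in\mathbb N$, let $\Lambda$ be a Borel probability measure on $\mathbb R^d$, let $k(x,y)=\int_{\mathbb R^d}\cos(\omega^T(x-y))\,d\Lambda(\omega)$ be the translation-invariant kernel on $\mathbb R^d$ with spectral measure $\Lambda$, let $S\subset\mathbb R^d$ be compact with Lebesgue measure $\mathrm{vol}(S)$, let $m\ge 1$ be an integer and $\tau>0$. Let $\omega_1,\dots,\omega_m$ be i.i.d. with law $\Lambda$ and let $\hat k(x,y)=\frac1m\sum_{j=1}^m\cos(\omega_j^T(x-y))$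 be the random Fourier feature approximation of $k$. Then, with probability at least $1-e^{-\tau}$, $$\|k-\hat k\|_{L^r(S\times S)}\le 2C'_r\,\mathrm{vol}^{2/r}(S)\,m^{\max(1/2,1/r)-1}+\mathrm{vol}^{2/r}(S)\sqrt{\frac{2\tau}{m}},$$ where the $L^r$ norm is taken with respect to Lebesgue measure on $S\times S$. -/

import Mathlib

open MeasureTheory
open scoped ENNReal RealInnerProductSpace

noncomputable section

/-- The expectation of `F ε` over a Rademacher sequence `ε = (ε₁, …, εₙ)`: the average of `F` over
all `2 ^ n` sign vectors. -/
def rademacherMean (n : ℕ) (F : (Fin n → ℝ) → ℝ) : ℝ :=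
  (∑ ε : Fin n → ℤˣ, F (fun i => ((ε i : ℤ) : ℝ))) / 2 ^ n

/-- `C` is a type-`q` constant of the normed space `E`:
`𝔼_ε ‖∑ εⱼ fⱼ‖ ≤ C (∑ ‖fⱼ‖ ^ q) ^ (1 / q)` for all finite families of vectors. -/
def IsTypeConstant (E : Type*) [NormedAddCommGroup E] [NormedSpace ℝ E] (q C : ℝ) : Prop :=
  ∀ (n : ℕ) (f : Fin n → E),
    rademacherMean n (fun ε => ‖∑ j, ε j • f j‖) ≤ C * (∑ j, ‖f j‖ ^ q) ^ (1 / q)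

/-- The universal constants in "every space `L^r(Ω, μ)` is of type `min(2, r)`": the real numbers
that are type-`min(2, r)` constants of all `L^r` spaces simultaneously (used for `1 < r`). -/
def lrTypeConstants (r : ℝ) : Set ℝ :=
  {C | ∀ [Fact (1 ≤ ENNReal.ofReal r)] (Ω : Type) [MeasurableSpace Ω] (μ : Measure Ω),
    IsTypeConstant (Lp ℝ (ENNReal.ofReal r) μ) (min 2 r) C}

/-- `Λ` is a spectral measure of the real translation-invariant kernel `k`:
`k(x, y) = ∫ cos(ωᵀ(x - y)) dΛ(ω)`. -/
def IsSpectralMeasure {d : ℕ} (Λ : Measure (EuclideanSpace ℝ (Fin d)))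
    (k : EuclideanSpace ℝ (Fin d) → EuclideanSpace ℝ (Fin d) → ℝ) : Prop :=
  ∀ x y, k x y = ∫ ω, Real.cos ⟪ω, x - y⟫ ∂Λ

/-- The random Fourier feature approximation `k̂(x, y) = (1 / m) ∑ⱼ cos(ωⱼᵀ(x - y))` built from the
frequencies `ω₁, …, ωₘ`. -/
def rffKernel {d m : ℕ} (ω : Fin m → EuclideanSpace ℝ (Fin d))
    (x y : EuclideanSpace ℝ (Fin d)) : ℝ :=
  (1 / (m : ℝ)) * ∑ j, Real.cos ⟪ω j, x - y⟫

end

/-!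
The error `k - k̂` is the deviation of an empirical mean from its expectation in the Banach space
`L^r(S × S)`: with `c ω = cos(ωᵀ(x - y))` regarded as an element of that space,
`k - k̂ = ∫ c dΛ - (1 / m) ∑ⱼ c(ωⱼ)`. Since `|cos| ≤ 1`, the vectors `c ω` have norm at most
`V = vol(S) ^ (2 / r)`. The vector-valued integral is taken in the space of continuous functions on
the compact set `S × S`, where evaluation at a point commutes with integration, and is then pushed
to `L^r` by a continuous linear map.

The bound has two parts, combined in `one_sub_exp_neg_le_measureReal_norm_empirical_le`.

* Concentration. Changing one frequency changes the norm of the error by at most `2 V / m`, so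
  McDiarmid's inequality (`hasSubgaussianMGF_pi_of_bounded_differences`) shows that this norm exceeds
  its expectation by `V √(2 τ / m)` with probability at most `exp (-τ)`.
* Expectation. Symmetrization (`integral_norm_sum_integral_sub_le_rademacherMean`) bounds the expected
  norm by `2 / m` times the mean of the Rademacher average of `c(ω₁), …, c(ωₘ)`, which is at most
  `C (m V ^ q) ^ (1 / q)` in a space of type `q = min(2, r)` with constant `C`.

That `L^r` has type `min(2, r)` with a constant independent of the measure space
(`isTypeConstant_Lp`) follows by applying Khintchine's inequality pointwise and estimating the
square function `(∑ fⱼ²) ^ (1 / 2)` in `L^r`. The set of universal constants is thus nonempty; it is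
closed and bounded below by `1`, so it has a least element.
-/

/-! ### Hoeffding's lemma and McDiarmid's inequality for bounded differences -/

open ProbabilityTheory in
/-- Hoeffding's lemma for a random variable whose oscillation is at most `c`. -/
theorem hasSubgaussianMGF_of_abs_sub_le {Ω : Type*} [MeasurableSpace Ω] {μ : Measure Ω}
    [IsProbabilityMeasure μ] {X : Ω → ℝ} (hX : Measurable X) (c : NNReal)
    (hc : ∀ x x', |X x - X x'| ≤ c) :
    HasSubgaussianMGF (fun x => X x - ∫ y, X y ∂μ) ((c / 2) ^ 2) μ := by
  obtain ⟨x₀⟩ : Nonempty Ω := nonempty_of_isProbabilityMeasure μ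
  have hbdd : BddBelow (Set.range X) :=
    ⟨X x₀ - c, by rintro _ ⟨x, rfl⟩; have := abs_le.1 (hc x₀ x); linarith⟩
  have hmem : ∀ x, X x ∈ Set.Icc (⨅ x, X x) ((⨅ x, X x) + c) := fun x => by
    have : Nonempty Ω := ⟨x₀⟩
    refine ⟨ciInf_le hbdd x, ?_⟩
    have : X x - c ≤ ⨅ x, X x := le_ciInf fun x' => by
      have := abs_le.1 (hc x x'); linarith
    linarith
  have h := hasSubgaussianMGF_of_mem_Icc (μ := μ) hX.aemeasurable (ae_of_all _ hmem)
  simpa using h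

open ProbabilityTheory in
/-- **McDiarmid's inequality**, in moment generating function form. The induction integrates out
one coordinate at a time and applies Hoeffding's lemma to it. -/
theorem hasSubgaussianMGF_pi_of_bounded_differences {Ω : Type*} [MeasurableSpace Ω] :
    ∀ {m : ℕ} (μ : Fin m → Measure Ω) [∀ i, IsProbabilityMeasure (μ i)]
      {f : (Fin m → Ω) → ℝ} (_ : Measurable f) {B : ℝ} (_ : ∀ ω, |f ω| ≤ B)
      (c : Fin m → NNReal)
      (_ : ∀ ω i x, |f ω - f (Function.update ω i x)| ≤ c i),
      HasSubgaussianMGF (fun ω => f ω - ∫ ω', f ω' ∂Measure.pi μ) (∑ i, (c i / 2) ^ 2)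
        (Measure.pi μ) := by
  intro m
  induction m with
  | zero =>
    intro μ _ f hf B hB c hc
    have hconst : ∀ ω, f ω - ∫ ω', f ω' ∂Measure.pi μ = 0 := fun ω => by
      have : ∀ ω', f ω' = f ω := fun ω' => congrArg f (Subsingleton.elim _ _)
      simp [this]
    simp only [hconst, Finset.univ_eq_empty, Finset.sum_empty]
    exact HasSubgaussianMGF.fun_zero
  | succ n ih =>
    intro μ _ f hf B hB c hc
    set ν := Measure.pi (fun j : Fin n => μ j.succ)
    let F : Ω × (Fin n → Ω) → ℝ := fun p => f (Fin.cons p.1 p.2)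
    have hmp : MeasurePreserving (MeasurableEquiv.piFinSuccAbove (fun _ : Fin (n + 1) => Ω) 0).symm
        ((μ 0).prod ν) (Measure.pi μ) := (measurePreserving_piFinSuccAbove μ 0).symm
    have hcons : ∀ p : Ω × (Fin n → Ω),
        (MeasurableEquiv.piFinSuccAbove (fun _ : Fin (n + 1) => Ω) 0).symm p
          = Fin.cons p.1 p.2 := fun p => by
      simp [MeasurableEquiv.piFinSuccAbove_symm_apply, Fin.insertNthEquiv]
    have hF : Measurable F := by
      have := hf.comp (MeasurableEquiv.piFinSuccAbove (fun _ : Fin (n + 1) => Ω) 0).symm.measurable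
      simpa only [Function.comp_def, hcons] using this
    have hint : ∀ φ : ℝ → ℝ, ∫ ω, φ (f ω) ∂Measure.pi μ = ∫ p, φ (F p) ∂(μ 0).prod ν := fun φ => by
      rw [← hmp.integral_comp' (fun ω => φ (f ω))]
      simp only [hcons, F]
    have hFB : ∀ p, |F p| ≤ B := fun p => hB _
    have hFi : Integrable F ((μ 0).prod ν) :=
      .of_bound hF.aestronglyMeasurable B (ae_of_all _ hFB)
    have hFx : ∀ y, Measurable fun x => F (x, y) := fun y => hF.comp measurable_prodMk_right
    have hFxi : ∀ y, Integrable (fun x => F (x, y)) (μ 0) := fun y =>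
      .of_bound (hFx y).aestronglyMeasurable B (ae_of_all _ fun x => hFB _)
    let g : (Fin n → Ω) → ℝ := fun y => ∫ x, F (x, y) ∂μ 0
    have hg : Measurable g := (hF.stronglyMeasurable.integral_prod_left').measurable
    have hgB : ∀ y, |g y| ≤ B := fun y => by
      simpa using norm_integral_le_of_norm_le_const (μ := μ 0) (f := fun x => F (x, y))
        (ae_of_all _ fun x => hFB (x, y))
    have hEg : ∫ ω, f ω ∂Measure.pi μ = ∫ y, g y ∂ν := by
      rw [hint (fun x => x), integral_prod_symm _ hFi]
    have hgc : ∀ y (i : Fin n) x, |g y - g (Function.update y i x)| ≤ c i.succ := fun y i x => by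
      have h1 : g y - g (Function.update y i x)
          = ∫ z, (F (z, y) - F (z, Function.update y i x)) ∂μ 0 :=
        (integral_sub (hFxi _) (hFxi _)).symm
      rw [h1]
      have h2 : ∀ z, ‖F (z, y) - F (z, Function.update y i x)‖ ≤ c i.succ := fun z => by
        have := hc (Fin.cons z y) i.succ x
        rwa [← Fin.cons_update] at this
      simpa using norm_integral_le_of_norm_le_const (μ := μ 0) (ae_of_all _ h2)
    have hFc : ∀ y x x', |F (x, y) - F (x', y)| ≤ c 0 := fun y x x' => by
      have := hc (Fin.cons x y) 0 x'
      rwa [Fin.update_cons_zero] at this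
    have ihg := ih (fun j => μ j.succ) hg hgB (fun j => c j.succ) hgc
    rw [hEg]
    have hb : ∀ t, ∀ ω, ‖Real.exp (t * (f ω - ∫ y, g y ∂ν))‖
        ≤ Real.exp (|t| * (B + |∫ y, g y ∂ν|)) := fun t ω => by
      rw [Real.norm_eq_abs, Real.abs_exp]
      refine Real.exp_le_exp.2 ((le_abs_self _).trans ?_)
      rw [abs_mul]
      refine mul_le_mul_of_nonneg_left ((abs_sub _ _).trans ?_) (abs_nonneg t)
      linarith [hB ω]
    refine ⟨fun t => .of_bound (by fun_prop) _ (ae_of_all _ (hb t)), fun t => ?_⟩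
    have hH := fun y => (hasSubgaussianMGF_of_abs_sub_le (μ := μ 0) (hFx y) (c 0) (hFc y)).mgf_le t
    have hprod : Integrable (fun p => Real.exp (t * (F p - ∫ y, g y ∂ν))) ((μ 0).prod ν) :=
      .of_bound (by fun_prop) _ (ae_of_all _ fun p => hb t _)
    -- split off `F (x, y) - g y`, which is centred in `x` and oscillates by at most `c 0`
    have key : mgf (fun ω => f ω - ∫ y, g y ∂ν) (Measure.pi μ) t
        ≤ Real.exp (((c 0 / 2) ^ 2 : NNReal) * t ^ 2 / 2)
          * mgf (fun y => g y - ∫ y, g y ∂ν) ν t := by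
      unfold mgf
      rw [hint (fun z => Real.exp (t * (z - ∫ y, g y ∂ν))), integral_prod_symm _ hprod,
        ← integral_const_mul]
      refine integral_mono hprod.integral_prod_right ((ihg.integrable_exp_mul t).const_mul _)
        fun y => ?_
      have : ∀ x, Real.exp (t * (F (x, y) - ∫ y, g y ∂ν))
          = Real.exp (t * (F (x, y) - g y)) * Real.exp (t * (g y - ∫ y, g y ∂ν)) := fun x => by
        rw [← Real.exp_add]; ring_nf
      simp only [this]
      rw [integral_mul_const]
      exact mul_le_mul_of_nonneg_right (hH y) (Real.exp_pos _).le
    refine key.trans ((mul_le_mul_of_nonneg_left (ihg.mgf_le t) (Real.exp_pos _).le).trans_eq ?_)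
    rw [← Real.exp_add, Fin.sum_univ_succ]
    push_cast
    ring_nf

/-! ### Symmetrization of empirical means in a Banach space -/

theorem rademacherMean_mono {n : ℕ} {F G : (Fin n → ℝ) → ℝ} (h : ∀ ε, F ε ≤ G ε) :
    rademacherMean n F ≤ rademacherMean n G :=
  div_le_div_of_nonneg_right (Finset.sum_le_sum fun _ _ => h _) (by positivity)

theorem rademacherMean_const (n : ℕ) (a : ℝ) : rademacherMean n (fun _ => a) = a := by
  simp [rademacherMean]

theorem integral_rademacherMean {Ω : Type*} [MeasurableSpace Ω] {μ : Measure Ω} {n : ℕ}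
    {F : Ω → (Fin n → ℝ) → ℝ} (hF : ∀ ε, Integrable (fun x => F x ε) μ) :
    ∫ x, rademacherMean n (F x) ∂μ = rademacherMean n (fun ε => ∫ x, F x ε ∂μ) := by
  simp only [rademacherMean]
  rw [integral_div, integral_finsetSum _ fun _ _ => hF _]

theorem MeasureTheory.MeasurePreserving.integral_comp_of_stronglyMeasurable
    {α β E : Type*} [MeasurableSpace α] [MeasurableSpace β] [NormedAddCommGroup E]
    [NormedSpace ℝ E] {μ : Measure α} {ν : Measure β} {T : α → β} (hT : MeasurePreserving T μ ν)
    {f : β → E} (hf : StronglyMeasurable f) : ∫ x, f (T x) ∂μ = ∫ y, f y ∂ν := by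
  rw [← hT.map_eq, integral_map hT.measurable.aemeasurable hf.aestronglyMeasurable]

theorem norm_sum_smul_le {Ω E : Type*} [NormedAddCommGroup E]
    [NormedSpace ℝ E] {m : ℕ} {c : Ω → E} {V : ℝ} (hV : ∀ x, ‖c x‖ ≤ V)
    (ε : Fin m → ℝ) (ω : Fin m → Ω) : ‖∑ j, ε j • c (ω j)‖ ≤ ∑ j, |ε j| * V :=
  (norm_sum_le _ _).trans <| Finset.sum_le_sum fun j _ => by
    rw [norm_smul, Real.norm_eq_abs]
    exact mul_le_mul_of_nonneg_left (hV _) (abs_nonneg _)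

section Symmetrization

variable {Ω E : Type*} [MeasurableSpace Ω] [NormedAddCommGroup E] [NormedSpace ℝ E]

theorem stronglyMeasurable_sum_smul_eval {m : ℕ} {c : Ω → E} (hc : StronglyMeasurable c)
    (ε : Fin m → ℝ) : StronglyMeasurable fun ω : Fin m → Ω => ∑ j, ε j • c (ω j) :=
  Finset.stronglyMeasurable_fun_sum _ fun j _ =>
    (hc.comp_measurable (measurable_pi_apply j)).const_smul (ε j)

/-- Jensen's inequality in the second copy: the mean of `c` may be replaced by an independent
sample. -/
theorem integral_norm_sum_integral_sub_le [CompleteSpace E] {μ : Measure Ω}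
    [IsProbabilityMeasure μ] {m : ℕ} {c : Ω → E} (hc : StronglyMeasurable c) {V : ℝ}
    (hV : ∀ x, ‖c x‖ ≤ V) :
    ∫ ω, ‖∑ j, ((∫ x, c x ∂μ) - c (ω j))‖ ∂Measure.pi (fun _ : Fin m => μ)
      ≤ ∫ z, ‖∑ j, (c (z j).2 - c (z j).1)‖ ∂Measure.pi (fun _ : Fin m => μ.prod μ) := by
  set P := Measure.pi (fun _ : Fin m => μ)
  have hs : StronglyMeasurable fun ω : Fin m → Ω => ∑ j, c (ω j) := by
    simpa using stronglyMeasurable_sum_smul_eval hc (fun _ : Fin m => (1 : ℝ))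
  have hb : ∀ ω : Fin m → Ω, ‖∑ j, c (ω j)‖ ≤ m * V := fun ω => by
    simpa using norm_sum_smul_le hV (fun _ : Fin m => (1 : ℝ)) ω
  have hsi : Integrable (fun ω : Fin m → Ω => ∑ j, c (ω j)) P :=
    .of_bound hs.aestronglyMeasurable _ (ae_of_all _ hb)
  have hci : ∀ j : Fin m, Integrable (fun ω : Fin m → Ω => c (ω j)) P := fun j =>
    .of_bound (hc.comp_measurable (measurable_pi_apply j)).aestronglyMeasurable V
      (ae_of_all _ fun ω => hV _)
  have hmean : ∫ ω, ∑ j, c (ω j) ∂P = ∑ _j : Fin m, ∫ x, c x ∂μ := by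
    rw [integral_finsetSum _ fun j _ => hci j]
    exact Finset.sum_congr rfl fun j _ =>
      (measurePreserving_eval (fun _ : Fin m => μ) j).integral_comp_of_stronglyMeasurable hc
  have hsm2 : StronglyMeasurable fun p : (Fin m → Ω) × (Fin m → Ω) =>
      ‖∑ j, c (p.2 j) - ∑ j, c (p.1 j)‖ :=
    ((hs.comp_measurable measurable_snd).sub (hs.comp_measurable measurable_fst)).norm
  have hi2 : Integrable (fun p : (Fin m → Ω) × (Fin m → Ω) =>
      ‖∑ j, c (p.2 j) - ∑ j, c (p.1 j)‖) (P.prod P) :=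
    .of_bound hsm2.aestronglyMeasurable (m * V + m * V) (ae_of_all _ fun p => by
      rw [norm_norm]; exact (norm_sub_le _ _).trans (add_le_add (hb _) (hb _)))
  have hmp := measurePreserving_arrowProdEquivProdArrow Ω Ω (Fin m) (fun _ => μ) (fun _ => μ)
  have hrhs : ∫ z, ‖∑ j, (c (z j).2 - c (z j).1)‖ ∂Measure.pi (fun _ : Fin m => μ.prod μ)
      = ∫ ω, ∫ ω', ‖∑ j, c (ω' j) - ∑ j, c (ω j)‖ ∂P ∂P := by
    rw [← integral_prod _ hi2, ← hmp.integral_comp_of_stronglyMeasurable hsm2]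
    simp [MeasurableEquiv.arrowProdEquivProdArrow, Equiv.arrowProdEquivProdArrow]
  rw [hrhs]
  refine integral_mono ?_ hi2.integral_prod_left fun ω => ?_
  · simp only [Finset.sum_sub_distrib]
    exact ((integrable_const _).sub hsi).norm
  · have : ∑ j, ((∫ x, c x ∂μ) - c (ω j)) = ∫ ω', (∑ j, c (ω' j) - ∑ j, c (ω j)) ∂P := by
      rw [integral_sub hsi (integrable_const _), hmean, Finset.sum_sub_distrib]
      simp
    simp only [this]
    exact norm_integral_le_integral_norm _

/-- **Symmetrization**: an empirical mean deviates from its expectation by at most twice the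
Rademacher average of the sample. Exchanging `(z j).1` and `(z j).2` where `ε j = -1` preserves the
law of `z`. -/
theorem integral_norm_sum_integral_sub_le_rademacherMean [CompleteSpace E] {μ : Measure Ω}
    [IsProbabilityMeasure μ] {m : ℕ} {c : Ω → E} (hc : StronglyMeasurable c) {V : ℝ}
    (hV : ∀ x, ‖c x‖ ≤ V) :
    ∫ ω, ‖∑ j, ((∫ x, c x ∂μ) - c (ω j))‖ ∂Measure.pi (fun _ : Fin m => μ)
      ≤ 2 * ∫ ω, rademacherMean m (fun ε => ‖∑ j, ε j • c (ω j)‖)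
          ∂Measure.pi (fun _ : Fin m => μ) := by
  set P := Measure.pi (fun _ : Fin m => μ)
  set Q := Measure.pi (fun _ : Fin m => μ.prod μ)
  have hint : ∀ ε : Fin m → ℝ, Integrable (fun ω : Fin m → Ω => ‖∑ j, ε j • c (ω j)‖) P := fun ε =>
    .of_bound (stronglyMeasurable_sum_smul_eval hc ε).norm.aestronglyMeasurable (∑ j, |ε j| * V)
      (ae_of_all _ fun ω => by rw [norm_norm]; exact norm_sum_smul_le hV ε ω)
  have hfst : MeasurePreserving (fun (z : Fin m → Ω × Ω) j => (z j).1) Q P :=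
    measurePreserving_pi _ _ fun _ => measurePreserving_fst
  have hsnd : MeasurePreserving (fun (z : Fin m → Ω × Ω) j => (z j).2) Q P :=
    measurePreserving_pi _ _ fun _ => measurePreserving_snd
  have hd : StronglyMeasurable fun w : Ω × Ω => c w.2 - c w.1 :=
    (hc.comp_measurable measurable_snd).sub (hc.comp_measurable measurable_fst)
  have hdV : ∀ w : Ω × Ω, ‖c w.2 - c w.1‖ ≤ V + V := fun w =>
    (norm_sub_le _ _).trans (add_le_add (hV _) (hV _))
  have hswap : ∀ ε : Fin m → ℤˣ, ∫ z, ‖∑ j, (c (z j).2 - c (z j).1)‖ ∂Q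
      = ∫ z, ‖∑ j, ((ε j : ℤ) : ℝ) • (c (z j).2 - c (z j).1)‖ ∂Q := fun ε => by
    have hT : MeasurePreserving
        (fun (z : Fin m → Ω × Ω) j => (if ε j = 1 then id else Prod.swap) (z j)) Q Q :=
      measurePreserving_pi (f := fun j => if ε j = 1 then id else Prod.swap) _ _ fun j => by
        split_ifs
        · exact .id _
        · exact Measure.measurePreserving_swap
    have hsm : StronglyMeasurable fun z : Fin m → Ω × Ω => ‖∑ j, (c (z j).2 - c (z j).1)‖ := by
      simpa using (stronglyMeasurable_sum_smul_eval hd (fun _ : Fin m => (1 : ℝ))).norm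
    rw [← hT.integral_comp_of_stronglyMeasurable hsm]
    refine integral_congr_ae (ae_of_all _ fun z => ?_)
    refine congrArg norm (Finset.sum_congr rfl fun j _ => ?_)
    rcases Int.units_eq_one_or (ε j) with h | h <;> simp [h]
  have hbound : ∀ ε : Fin m → ℝ, ∫ z, ‖∑ j, ε j • (c (z j).2 - c (z j).1)‖ ∂Q
      ≤ 2 * ∫ ω, ‖∑ j, ε j • c (ω j)‖ ∂P := fun ε => by
    have h2 := hsnd.integral_comp_of_stronglyMeasurable (stronglyMeasurable_sum_smul_eval hc ε).norm
    have h1 := hfst.integral_comp_of_stronglyMeasurable (stronglyMeasurable_sum_smul_eval hc ε).norm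
    have hadd := integral_add (hsnd.integrable_comp_of_integrable (hint ε))
      (hfst.integrable_comp_of_integrable (hint ε))
    simp only [Function.comp_def] at hadd
    rw [h1, h2, ← two_mul] at hadd
    rw [← hadd]
    refine integral_mono (.of_bound (stronglyMeasurable_sum_smul_eval hd
      ε).norm.aestronglyMeasurable (∑ j, |ε j| * (V + V)) (ae_of_all _ fun z => ?_))
      ((hsnd.integrable_comp_of_integrable (hint ε)).add
        (hfst.integrable_comp_of_integrable (hint ε))) fun z => ?_
    · rw [norm_norm]; exact norm_sum_smul_le hdV ε z
    · simp only [smul_sub, Finset.sum_sub_distrib]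
      exact norm_sub_le _ _
  calc _ ≤ ∫ z, ‖∑ j, (c (z j).2 - c (z j).1)‖ ∂Q := integral_norm_sum_integral_sub_le hc hV
    _ = (∑ _ε : Fin m → ℤˣ, ∫ z, ‖∑ j, (c (z j).2 - c (z j).1)‖ ∂Q) / 2 ^ m :=
        (rademacherMean_const m _).symm
    _ ≤ (∑ ε : Fin m → ℤˣ, 2 * ∫ ω, ‖∑ j, ((ε j : ℤ) : ℝ) • c (ω j)‖ ∂P) / 2 ^ m := by
        gcongr with ε
        rw [hswap ε]
        exact hbound _
    _ = 2 * ∫ ω, rademacherMean m (fun ε => ‖∑ j, ε j • c (ω j)‖) ∂P := by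
        rw [integral_rademacherMean hint, rademacherMean, ← Finset.mul_sum, mul_div_assoc]

end Symmetrization

/-! ### Concentration of empirical means in spaces of given type -/

open ProbabilityTheory in
/-- In a space of type `q` with constant `C`, the empirical mean of `m` independent samples of a
vector bounded by `V` deviates from its expectation by at most
`2 C V m ^ (1 / q - 1) + V √(2 τ / m)`, up to probability `exp (-τ)`. -/
theorem one_sub_exp_neg_le_measureReal_norm_empirical_le {Ω E : Type*} [MeasurableSpace Ω]
    [NormedAddCommGroup E] [NormedSpace ℝ E] [CompleteSpace E] {μ : Measure Ω}
    [IsProbabilityMeasure μ] {q C : ℝ} (hq : 0 < q) (hC : 0 ≤ C) (hE : IsTypeConstant E q C)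
    {c : Ω → E} (hc : StronglyMeasurable c) {V : ℝ} (hV : ∀ x, ‖c x‖ ≤ V) {m : ℕ} (hm : 0 < m)
    {τ : ℝ} (hτ : 0 < τ) :
    1 - Real.exp (-τ) ≤ (Measure.pi (fun _ : Fin m => μ)).real
      {ω | ‖(∫ x, c x ∂μ) - (1 / (m : ℝ)) • ∑ j, c (ω j)‖
        ≤ 2 * C * V * (m : ℝ) ^ (1 / q - 1) + V * √(2 * τ / m)} := by
  set P := Measure.pi (fun _ : Fin m => μ)
  set f : (Fin m → Ω) → ℝ := fun ω => ‖(∫ x, c x ∂μ) - (1 / (m : ℝ)) • ∑ j, c (ω j)‖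
  have hm' : (0 : ℝ) < m := Nat.cast_pos.2 hm
  obtain ⟨x₀⟩ : Nonempty Ω := nonempty_of_isProbabilityMeasure μ
  have hV0 : 0 ≤ V := (norm_nonneg _).trans (hV x₀)
  have hs : StronglyMeasurable fun ω : Fin m → Ω => ∑ j, c (ω j) := by
    simpa using stronglyMeasurable_sum_smul_eval hc (fun _ : Fin m => (1 : ℝ))
  have hf : Measurable f := (stronglyMeasurable_const.sub (hs.const_smul _)).norm.measurable
  have hfe : ∀ ω, f ω = (1 / m) * ‖∑ j, ((∫ x, c x ∂μ) - c (ω j))‖ := fun ω => by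
    rw [← abs_of_pos (one_div_pos.2 hm'), ← Real.norm_eq_abs, ← norm_smul,
      Finset.sum_sub_distrib, smul_sub]
    simp [f, ← Nat.cast_smul_eq_nsmul ℝ, smul_smul, hm'.ne']
  have hmean : ‖∫ x, c x ∂μ‖ ≤ V := by
    simpa using norm_integral_le_of_norm_le_const (μ := μ) (ae_of_all _ hV)
  have hfB : ∀ ω, |f ω| ≤ V + V := fun ω => by
    rw [abs_of_nonneg (show 0 ≤ f ω from norm_nonneg _), hfe]
    have : ‖∑ j, ((∫ x, c x ∂μ) - c (ω j))‖ ≤ m * (V + V) := by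
      refine (norm_sum_le _ _).trans ((Finset.sum_le_sum fun j _ =>
        (norm_sub_le _ _).trans (add_le_add hmean (hV _))).trans_eq ?_)
      rw [Finset.sum_const, Finset.card_univ, Fintype.card_fin, nsmul_eq_mul]
    rw [one_div, inv_mul_le_iff₀ hm']
    exact this
  have hEf : ∫ ω, f ω ∂P ≤ 2 * C * V * (m : ℝ) ^ (1 / q - 1) := by
    simp only [hfe]
    rw [integral_const_mul]
    have h1 := integral_norm_sum_integral_sub_le_rademacherMean (μ := μ) (m := m) hc hV
    have h2 : ∫ ω, rademacherMean m (fun ε => ‖∑ j, ε j • c (ω j)‖) ∂P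
        ≤ C * (m * V ^ q) ^ (1 / q) := by
      refine (integral_mono_of_nonneg (ae_of_all _ fun ω => ?_)
        (integrable_const (C * (m * V ^ q) ^ (1 / q))) (ae_of_all _ fun ω => ?_)).trans_eq ?_
      · exact div_nonneg (Finset.sum_nonneg fun _ _ => norm_nonneg _) (by positivity)
      · refine (hE m fun j => c (ω j)).trans (mul_le_mul_of_nonneg_left ?_ hC)
        refine Real.rpow_le_rpow (by positivity) ?_ (by positivity)
        refine (Finset.sum_le_sum fun j _ =>
          Real.rpow_le_rpow (norm_nonneg _) (hV _) hq.le).trans_eq ?_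
        simp
      · simp
    have h3 : (m * V ^ q) ^ (1 / q) = (m : ℝ) ^ (1 / q) * V := by
      rw [Real.mul_rpow hm'.le (by positivity), ← Real.rpow_mul hV0, mul_one_div_cancel hq.ne',
        Real.rpow_one]
    rw [Real.rpow_sub_one hm'.ne']
    rw [h3] at h2
    calc _ ≤ 1 / (m : ℝ) * (2 * (C * ((m : ℝ) ^ (1 / q) * V))) := by gcongr; linarith
      _ = _ := by ring
  have hdiff : ∀ ω i x, |f ω - f (Function.update ω i x)|
      ≤ ((Real.toNNReal (2 * V / m) : NNReal) : ℝ) := fun ω i x => by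
    rw [Real.coe_toNNReal _ (by positivity), hfe, hfe, ← mul_sub, abs_mul,
      abs_of_pos (one_div_pos.2 hm'), one_div, inv_mul_le_iff₀ hm', mul_div_cancel₀ _ hm'.ne']
    refine (abs_norm_sub_norm_le _ _).trans ?_
    rw [← Finset.sum_sub_distrib, Finset.sum_eq_single i]
    · simp only [Function.update_self, sub_sub_sub_cancel_left]
      refine (norm_sub_le _ _).trans ?_
      linarith [hV x, hV (ω i)]
    · intro j _ hj
      simp [Function.update_of_ne hj]
    · simp
  have hsub := hasSubgaussianMGF_pi_of_bounded_differences (fun _ : Fin m => μ) hf hfB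
    (fun _ => Real.toNNReal (2 * V / m)) hdiff
  have hmeas : MeasurableSet
      {ω | f ω ≤ 2 * C * V * (m : ℝ) ^ (1 / q - 1) + V * √(2 * τ / m)} :=
    measurableSet_le hf measurable_const
  rcases hV0.eq_or_lt with hV0 | hV0
  · -- the sub-Gaussian parameter vanishes, but so does `f`
    have : {ω | f ω ≤ 2 * C * V * (m : ℝ) ^ (1 / q - 1) + V * √(2 * τ / m)} = Set.univ := by
      refine Set.eq_univ_of_forall fun ω => ?_
      have := le_of_abs_le (hfB ω)
      simpa [← hV0] using this
    rw [this]
    simp [Real.exp_nonneg]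
  have htail := hsub.measure_ge_le (ε := V * √(2 * τ / m)) (by positivity)
  have hpar : -(V * √(2 * τ / m)) ^ 2
      / (2 * ((∑ _i : Fin m, (Real.toNNReal (2 * V / m) / 2) ^ 2 : NNReal) : ℝ)) = -τ := by
    push_cast
    rw [Real.coe_toNNReal _ (by positivity), mul_pow, Real.sq_sqrt (by positivity)]
    simp only [Finset.sum_const, Finset.card_univ, Fintype.card_fin, nsmul_eq_mul]
    field_simp
  rw [hpar] at htail
  have hcompl := probReal_compl_eq_one_sub (μ := P) hmeas
  have hle : P.real {ω | f ω ≤ 2 * C * V * (m : ℝ) ^ (1 / q - 1) + V * √(2 * τ / m)}ᶜ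
      ≤ Real.exp (-τ) := by
    refine le_trans (measureReal_mono fun ω hω => ?_) htail
    simp only [Set.mem_compl_iff, Set.mem_ofPred_eq, not_le] at hω ⊢
    linarith
  linarith

/-! ### Khintchine's inequality -/

theorem rademacherMean_prod {n : ℕ} (g : Fin n → ℝ → ℝ) :
    rademacherMean n (fun ε => ∏ j, g j (ε j)) = ∏ j, (g j 1 + g j (-1)) / 2 := by
  have h : ∏ j, (g j 1 + g j (-1)) = ∏ j : Fin n, ∑ u : ℤˣ, g j ((u : ℤ) : ℝ) := by
    refine Finset.prod_congr rfl fun j _ => ?_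
    rw [show (Finset.univ : Finset ℤˣ) = {1, -1} from rfl, Finset.sum_pair (by decide)]
    simp
  rw [Finset.prod_div_distrib, h, Finset.prod_univ_sum, Fintype.piFinset_univ]
  simp [rademacherMean]

/-- Rademacher sums are sub-Gaussian. -/
theorem rademacherMean_exp_sum_le {n : ℕ} (a : Fin n → ℝ) :
    rademacherMean n (fun ε => Real.exp (∑ j, ε j * a j)) ≤ Real.exp ((∑ j, a j ^ 2) / 2) := by
  simp only [Real.exp_sum]
  rw [rademacherMean_prod (fun j x => Real.exp (x * a j)), Finset.sum_div, Real.exp_sum]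
  refine Finset.prod_le_prod (fun j _ => by positivity) fun j _ => ?_
  have := Real.cosh_le_exp_half_sq (a j)
  rw [Real.cosh_eq] at this
  simpa using this

theorem rademacherMean_const_mul (n : ℕ) (b : ℝ) (F : (Fin n → ℝ) → ℝ) :
    rademacherMean n (fun ε => b * F ε) = b * rademacherMean n F := by
  rw [rademacherMean, rademacherMean, ← Finset.mul_sum, mul_div_assoc]

theorem rademacherMean_add (n : ℕ) (F G : (Fin n → ℝ) → ℝ) :
    rademacherMean n (fun ε => F ε + G ε) = rademacherMean n F + rademacherMean n G := by
  simp only [rademacherMean, Finset.sum_add_distrib, add_div]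

theorem abs_rpow_le_mul_exp_add_exp_neg {r : ℝ} (hr : 0 < r) (x : ℝ) :
    |x| ^ r ≤ r ^ r * (Real.exp x + Real.exp (-x)) := by
  -- raise `t ≤ exp t` at `t = |x| / r` to the power `r`
  have h1 : |x| / r ≤ Real.exp (|x| / r) := by linarith [Real.add_one_le_exp (|x| / r)]
  have h2 := Real.rpow_le_rpow (by positivity) h1 hr.le
  rw [← Real.exp_mul, div_mul_cancel₀ _ hr.ne', Real.div_rpow (abs_nonneg x) hr.le,
    div_le_iff₀ (by positivity), mul_comm] at h2
  refine h2.trans (mul_le_mul_of_nonneg_left ?_ (by positivity))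
  rcases abs_cases x with ⟨h, _⟩ | ⟨h, _⟩ <;> rw [h] <;> linarith [Real.exp_pos x, Real.exp_pos (-x)]

/-- **Khintchine's inequality** (upper bound). After normalization `∑ a j ^ 2 = 1` it follows from
the sub-Gaussian bound, as `|x| ^ r` is dominated by a multiple of `cosh x`. -/
theorem rademacherMean_abs_rpow_le {r : ℝ} (hr : 0 < r) {n : ℕ} (a : Fin n → ℝ) :
    rademacherMean n (fun ε => |∑ j, ε j * a j| ^ r)
      ≤ 2 * r ^ r * Real.exp (1 / 2) * (∑ j, a j ^ 2) ^ (r / 2) := by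
  set s := ∑ j, a j ^ 2
  have hs0 : 0 ≤ s := Finset.sum_nonneg fun j _ => sq_nonneg _
  rcases hs0.eq_or_lt with hs | hs
  · have ha : ∀ j, a j = 0 := fun j =>
      pow_eq_zero_iff two_ne_zero |>.1
        ((Finset.sum_eq_zero_iff_of_nonneg fun j _ => sq_nonneg _).1 hs.symm j (Finset.mem_univ j))
    have h0 : (0 : ℝ) ^ r = 0 := Real.zero_rpow hr.ne'
    simp only [ha, mul_zero, Finset.sum_const_zero, abs_zero, h0, rademacherMean_const]
    positivity
  · have hσ : 0 < √s := Real.sqrt_pos.2 hs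
    have key : ∀ t : ℝ, t ^ 2 = 1 → rademacherMean n
        (fun ε => Real.exp (t * ((∑ j, ε j * a j) / √s))) ≤ Real.exp (1 / 2) := fun t ht => by
      have h := rademacherMean_exp_sum_le (fun j => t * (a j / √s))
      have e1 : ∑ j, (t * (a j / √s)) ^ 2 = 1 := by
        simp only [mul_pow, div_pow, ht, one_mul, Real.sq_sqrt hs0]
        rw [← Finset.sum_div, div_self hs.ne']
      have e2 : ∀ ε : Fin n → ℝ,
          ∑ j, ε j * (t * (a j / √s)) = t * ((∑ j, ε j * a j) / √s) := fun ε => by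
        rw [Finset.sum_div, Finset.mul_sum]
        exact Finset.sum_congr rfl fun j _ => by ring
      rw [e1] at h
      simpa only [e2] using h
    have hpt : ∀ ε : Fin n → ℝ, |∑ j, ε j * a j| ^ r ≤ s ^ (r / 2) * (r ^ r *
        (Real.exp (1 * ((∑ j, ε j * a j) / √s)) + Real.exp (-1 * ((∑ j, ε j * a j) / √s)))) :=
      fun ε => by
        have h := abs_rpow_le_mul_exp_add_exp_neg hr ((∑ j, ε j * a j) / √s)
        have e : s ^ (r / 2) = √s ^ r := by
          rw [Real.sqrt_eq_rpow, ← Real.rpow_mul hs0]; ring_nf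
        rw [abs_div, abs_of_pos hσ, Real.div_rpow (abs_nonneg _) hσ.le,
          div_le_iff₀ (by positivity)] at h
        rw [e, one_mul, neg_one_mul]
        linarith
    refine (rademacherMean_mono hpt).trans ?_
    rw [rademacherMean_const_mul, rademacherMean_const_mul, rademacherMean_add]
    have := add_le_add (key 1 (by norm_num)) (key (-1) (by norm_num))
    calc _ ≤ s ^ (r / 2) * (r ^ r * (Real.exp (1 / 2) + Real.exp (1 / 2))) := by gcongr
      _ = _ := by ring

/-! ### The type of `L^r` spaces -/

theorem rademacherMean_le_rpow {r : ℝ} (hr : 1 ≤ r) {n : ℕ} {F : (Fin n → ℝ) → ℝ}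
    (hF : ∀ ε, 0 ≤ F ε) :
    rademacherMean n F ≤ rademacherMean n (fun ε => F ε ^ r) ^ (1 / r) := by
  have h := Real.rpow_arith_mean_le_arith_mean_rpow Finset.univ
    (fun _ : Fin n → ℤˣ => (1 : ℝ) / 2 ^ n) (fun ε => F fun i => ((ε i : ℤ) : ℝ))
    (fun _ _ => by positivity) (by simp) (fun _ _ => hF _) hr
  simp only [one_div, inv_mul_eq_div, ← Finset.sum_div] at h
  have h0 : 0 ≤ rademacherMean n F :=
    div_nonneg (Finset.sum_nonneg fun _ _ => hF _) (by positivity)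
  have h1 : 0 ≤ rademacherMean n (fun ε => F ε ^ r) :=
    div_nonneg (Finset.sum_nonneg fun _ _ => Real.rpow_nonneg (hF _) _) (by positivity)
  rw [one_div, Real.le_rpow_inv_iff_of_pos h0 h1 (by linarith)]
  exact h

theorem rpow_sum_le_sum_rpow {ι : Type*} (s : Finset ι) {p : ℝ} (hp0 : 0 < p) (hp1 : p ≤ 1)
    {b : ι → ℝ} (hb : ∀ i ∈ s, 0 ≤ b i) : (∑ i ∈ s, b i) ^ p ≤ ∑ i ∈ s, b i ^ p :=
  Finset.le_sum_of_subadditive_on_pred (fun x : ℝ => x ^ p) (fun x => 0 ≤ x)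
    (Real.zero_rpow hp0.ne').le (fun _ _ hx hy => Real.rpow_add_le_add_rpow hx hy hp0.le hp1)
    (fun _ _ hx hy => add_nonneg hx hy) b hb

section LpType

variable {Ω : Type*} [MeasurableSpace Ω] {μ : Measure Ω}

theorem eLpNorm_eq_ofReal_integral_abs_rpow {r : ℝ} (hr : 0 < r) {h : Ω → ℝ}
    (hh : MemLp h (ENNReal.ofReal r) μ) :
    eLpNorm h (ENNReal.ofReal r) μ = ENNReal.ofReal ((∫ x, |h x| ^ r ∂μ) ^ (1 / r)) := by
  have := hh.eLpNorm_eq_integral_rpow_norm (by simpa using hr) ENNReal.ofReal_ne_top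
  simpa [ENNReal.toReal_ofReal hr.le] using this

theorem norm_rpow_eq_integral {r : ℝ} (hr : 0 < r) (f : Lp ℝ (ENNReal.ofReal r) μ) :
    ‖f‖ ^ r = ∫ x, |f x| ^ r ∂μ := by
  have h0 : 0 ≤ ∫ x, |f x| ^ r ∂μ := integral_nonneg fun _ => by positivity
  rw [Lp.norm_def, eLpNorm_eq_ofReal_integral_abs_rpow hr (Lp.memLp f),
    ENNReal.toReal_ofReal (by positivity), ← Real.rpow_mul h0, one_div_mul_cancel hr.ne',
    Real.rpow_one]

theorem integrable_abs_rpow {r : ℝ} (hr : 0 < r) {h : Ω → ℝ}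
    (hh : MemLp h (ENNReal.ofReal r) μ) : Integrable (fun x => |h x| ^ r) μ := by
  have := hh.integrable_norm_rpow (by simpa using hr) ENNReal.ofReal_ne_top
  simpa [ENNReal.toReal_ofReal hr.le] using this

theorem memLp_sq {r : ℝ} (f : Lp ℝ (ENNReal.ofReal r) μ) :
    MemLp (fun x => f x ^ 2) (ENNReal.ofReal (r / 2)) μ := by
  have := (Lp.memLp f).norm_rpow_div (ENNReal.ofReal 2)
  rw [ENNReal.ofReal_div_of_pos two_pos]
  simpa using this

/-- The square function of `f₁, …, fₙ ∈ L^r` is controlled by the `ℓ^{min(2,r)}` norm of the norms: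
for `r ≤ 2` because `t ↦ t ^ (r / 2)` is subadditive, for `r ≥ 2` by Minkowski's inequality in
`L^{r/2}`. -/
theorem integrable_and_integral_sum_sq_rpow_le {r : ℝ} (hr : 1 < r)
    [Fact (1 ≤ ENNReal.ofReal r)] {n : ℕ}
    (f : Fin n → Lp ℝ (ENNReal.ofReal r) μ) :
    Integrable (fun x => (∑ j, f j x ^ 2) ^ (r / 2)) μ ∧
    (∫ x, (∑ j, f j x ^ 2) ^ (r / 2) ∂μ) ^ (1 / r)
      ≤ (∑ j, ‖f j‖ ^ (min 2 r)) ^ (1 / min 2 r) := by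
  have hr0 : 0 < r := by linarith
  have hmem : MemLp (fun x => ∑ j, f j x ^ 2) (ENNReal.ofReal (r / 2)) μ :=
    memLp_finsetSum _ fun j _ => memLp_sq (f j)
  have hnn : ∀ x, 0 ≤ ∑ j, f j x ^ 2 := fun x => Finset.sum_nonneg fun j _ => sq_nonneg _
  have hint : Integrable (fun x => (∑ j, f j x ^ 2) ^ (r / 2)) μ := by
    simpa only [abs_of_nonneg (hnn _)] using integrable_abs_rpow (by positivity) hmem
  refine ⟨hint, ?_⟩
  have hI0 : 0 ≤ ∫ x, (∑ j, f j x ^ 2) ^ (r / 2) ∂μ :=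
    integral_nonneg fun x => Real.rpow_nonneg (hnn x) _
  have hsq : ∀ j x, (f j x ^ 2) ^ (r / 2) = |f j x| ^ r := fun j x => by
    rw [← sq_abs, ← Real.rpow_natCast, ← Real.rpow_mul (abs_nonneg _)]
    congr 1; push_cast; ring
  rcases le_total r 2 with h2 | h2
  · rw [min_eq_right h2]
    refine Real.rpow_le_rpow hI0 ?_ (by positivity)
    have hi : ∀ j, Integrable (fun x => |f j x| ^ r) μ := fun j =>
      integrable_abs_rpow hr0 (Lp.memLp (f j))
    simp only [norm_rpow_eq_integral hr0]
    rw [← integral_finsetSum _ fun j _ => hi j]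
    refine integral_mono hint (integrable_finsetSum _ fun j _ => hi j) fun x => ?_
    simp only [← hsq]
    exact rpow_sum_le_sum_rpow _ (by positivity) (by linarith) fun j _ => sq_nonneg _
  · rw [min_eq_left h2]
    have hone : ∀ j, eLpNorm (fun x => f j x ^ 2) (ENNReal.ofReal (r / 2)) μ
        = ENNReal.ofReal (‖f j‖ ^ (2 : ℝ)) := fun j => by
      rw [eLpNorm_eq_ofReal_integral_abs_rpow (by positivity) (memLp_sq (f j))]
      simp only [abs_of_nonneg (sq_nonneg (f j _)), hsq]
      rw [← norm_rpow_eq_integral hr0, ← Real.rpow_mul (norm_nonneg _)]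
      congr 2; field_simp
    have hM := eLpNorm_sum_le (μ := μ) (f := fun j x => f j x ^ 2) (s := Finset.univ)
      (fun j _ => (memLp_sq (f j)).1) (p := ENNReal.ofReal (r / 2))
      (by rw [ENNReal.one_le_ofReal]; linarith)
    have hfun : (∑ j, fun x => f j x ^ 2) = fun x => ∑ j, f j x ^ 2 := by
      ext x; simp
    rw [hfun, eLpNorm_eq_ofReal_integral_abs_rpow (by positivity) hmem, Finset.sum_congr rfl
      fun j _ => hone j, ← ENNReal.ofReal_sum_of_nonneg fun _ _ => by positivity,
      ENNReal.ofReal_le_ofReal_iff (Finset.sum_nonneg fun _ _ => by positivity)] at hM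
    simp only [abs_of_nonneg (hnn _)] at hM
    have := Real.rpow_le_rpow (by positivity) hM (show (0 : ℝ) ≤ 1 / 2 by norm_num)
    rw [← Real.rpow_mul hI0] at this
    convert this using 2
    field_simp

/-- Every `L^r` space has type `min(2, r)`, with a constant depending only on `r`: by Khintchine's
inequality at each point, the Rademacher average is controlled by the square function. -/
theorem isTypeConstant_Lp {r : ℝ} (hr : 1 < r) [Fact (1 ≤ ENNReal.ofReal r)] :
    IsTypeConstant (Lp ℝ (ENNReal.ofReal r) μ) (min 2 r)
      ((2 * r ^ r * Real.exp (1 / 2)) ^ (1 / r)) := by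
  intro n f
  have hr0 : 0 < r := by linarith
  obtain ⟨hint, hle⟩ := integrable_and_integral_sum_sq_rpow_le hr f
  have hnorm : ∀ ε : Fin n → ℝ,
      ‖∑ j, ε j • f j‖ ^ r = ∫ x, |∑ j, ε j * f j x| ^ r ∂μ := fun ε => by
    rw [norm_rpow_eq_integral hr0]
    refine integral_congr_ae ?_
    have h1 := Lp.coeFn_finsetSum Finset.univ (fun j => ε j • f j)
    have h2 : ∀ᵐ x ∂μ, ∀ j, (ε j • f j) x = ε j * f j x :=
      ae_all_iff.2 fun j => Lp.coeFn_smul (ε j) (f j)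
    filter_upwards [h1, h2] with x hx1 hx2
    rw [hx1]
    simp [hx2]
  have hinti : ∀ ε : Fin n → ℝ, Integrable (fun x => |∑ j, ε j * f j x| ^ r) μ := fun ε =>
    integrable_abs_rpow hr0 (memLp_finsetSum _ fun j _ => (Lp.memLp (f j)).const_mul (ε j))
  refine (rademacherMean_le_rpow hr.le fun _ => norm_nonneg _).trans ?_
  simp only [hnorm]
  rw [← integral_rademacherMean hinti]
  have hI : ∫ x, rademacherMean n (fun ε => |∑ j, ε j * f j x| ^ r) ∂μ
      ≤ 2 * r ^ r * Real.exp (1 / 2) * ∫ x, (∑ j, f j x ^ 2) ^ (r / 2) ∂μ := by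
    rw [← integral_const_mul]
    exact integral_mono_of_nonneg
      (ae_of_all _ fun x => div_nonneg (Finset.sum_nonneg fun _ _ => by positivity) (by positivity))
      (hint.const_mul _) (ae_of_all _ fun x => rademacherMean_abs_rpow_le hr0 _)
  refine (Real.rpow_le_rpow (integral_nonneg fun x =>
    div_nonneg (Finset.sum_nonneg fun _ _ => by positivity) (by positivity)) hI
    (by positivity)).trans ?_
  rw [Real.mul_rpow (by positivity) (integral_nonneg fun x => Real.rpow_nonneg
    (Finset.sum_nonneg fun j _ => sq_nonneg _) _)]
  exact mul_le_mul_of_nonneg_left hle (by positivity)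

end LpType

/-! ### The optimal type constant -/

/-- The set of universal constants is bounded below: already the one-dimensional space `L^r` of a
point mass forces `C ≥ 1`, by taking a single unit vector. -/
theorem one_le_of_mem_lrTypeConstants {r : ℝ} (hr : 1 < r) {C : ℝ} (hC : C ∈ lrTypeConstants r) :
    1 ≤ C := by
  have : Fact (1 ≤ ENNReal.ofReal r) := ⟨by rw [ENNReal.one_le_ofReal]; exact hr.le⟩
  have hq : 0 < min 2 r := lt_min two_pos (by linarith)
  let u : Lp ℝ (ENNReal.ofReal r) (Measure.dirac ()) := Lp.const _ _ 1
  have hu : ‖u‖ = 1 := by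
    simp [u, Lp.norm_const' (p := ENNReal.ofReal r) (μ := Measure.dirac ()) (c := (1 : ℝ))
      (by simpa using zero_lt_one.trans hr) ENNReal.ofReal_ne_top]
  have h := hC Unit (Measure.dirac ()) 1 (fun _ => u)
  have h1 : ∀ ε : Fin 1 → ℤˣ, ‖∑ j, ((ε j : ℤ) : ℝ) • u‖ = 1 := fun ε => by
    rcases Int.units_eq_one_or (ε 0) with h | h <;> simp [h, hu]
  simp only [rademacherMean, h1, hu] at h
  simpa using h

/-- The smallest universal constant exists, since each defining inequality is a closed condition on
`C`. -/
theorem isLeast_sInf_lrTypeConstants {r : ℝ} (hr : 1 < r) :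
    IsLeast (lrTypeConstants r) (sInf (lrTypeConstants r)) := by
  have hbdd : BddBelow (lrTypeConstants r) := ⟨1, fun _ => one_le_of_mem_lrTypeConstants hr⟩
  have hne : (lrTypeConstants r).Nonempty := ⟨_, fun _ _ _ => isTypeConstant_Lp hr⟩
  have hcl : IsClosed (lrTypeConstants r) := by
    simp only [lrTypeConstants, IsTypeConstant, Set.ofPred_forall]
    refine isClosed_iInter fun _ => isClosed_iInter fun Ω => isClosed_iInter fun _ =>
      isClosed_iInter fun μ => isClosed_iInter fun n => isClosed_iInter fun f => ?_
    exact isClosed_le continuous_const (by fun_prop)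
  exact hcl.isLeast_csInf hne hbdd

/-! ### Random Fourier features -/

/-- The feature `(x, y) ↦ cos(ωᵀ(x - y))` as a continuous function on `S × S`. -/
noncomputable def cosFeature {d : ℕ} (S : Set (EuclideanSpace ℝ (Fin d)))
    (ω : EuclideanSpace ℝ (Fin d)) :
    C(↥(S ×ˢ S), ℝ) where
  toFun p := Real.cos ⟪ω, p.1.1 - p.1.2⟫
  continuous_toFun := by fun_prop

theorem continuous_cosFeature {d : ℕ} (S : Set (EuclideanSpace ℝ (Fin d))) :
    Continuous (cosFeature S) :=
  (ContinuousMap.curry ⟨fun q : EuclideanSpace ℝ (Fin d) × ↥(S ×ˢ S) =>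
    Real.cos ⟪q.1, q.2.1.1 - q.2.1.2⟫, by fun_prop⟩).continuous

theorem norm_cosFeature_le {d : ℕ} {S : Set (EuclideanSpace ℝ (Fin d))} [CompactSpace ↥(S ×ˢ S)]
    (ω : EuclideanSpace ℝ (Fin d)) : ‖cosFeature S ω‖ ≤ 1 :=
  (ContinuousMap.norm_le _ zero_le_one).2 fun _ => Real.abs_cos_le_one _

theorem mainTheorem3 (r : ℝ) (hr : 1 < r) :
    ∃ C : ℝ, IsLeast (lrTypeConstants r) C ∧
      ∀ (d : ℕ) (k : EuclideanSpace ℝ (Fin d) → EuclideanSpace ℝ (Fin d) → ℝ)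
        (Λ : Measure (EuclideanSpace ℝ (Fin d))) [IsProbabilityMeasure Λ],
        IsSpectralMeasure Λ k →
        ∀ (S : Set (EuclideanSpace ℝ (Fin d))), IsCompact S →
        ∀ (m : ℕ), 0 < m → ∀ (τ : ℝ), 0 < τ →
          1 - Real.exp (-τ) ≤ (Measure.pi (fun _ : Fin m => Λ)).real
            {ω | eLpNorm (fun p : EuclideanSpace ℝ (Fin d) × EuclideanSpace ℝ (Fin d) =>
                    k p.1 p.2 - rffKernel ω p.1 p.2)
                  (ENNReal.ofReal r) (volume.restrict (S ×ˢ S))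
                ≤ ENNReal.ofReal
                  (2 * C * volume.real S ^ (2 / r) * (m : ℝ) ^ (max (1 / 2) (1 / r) - 1)
                    + volume.real S ^ (2 / r) * √(2 * τ / m))} := by
  have : Fact (1 ≤ ENNReal.ofReal r) := ⟨by rw [ENNReal.one_le_ofReal]; exact hr.le⟩
  refine ⟨_, isLeast_sInf_lrTypeConstants hr, ?_⟩
  intro d k Λ _ hk S hS m hm τ hτ
  have hC := (isLeast_sInf_lrTypeConstants hr).1
  have hC0 := zero_le_one.trans (one_le_of_mem_lrTypeConstants hr hC)
  generalize sInf (lrTypeConstants r) = C at hC hC0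
  have hr0 : 0 < r := by linarith
  have hSS : IsCompact (S ×ˢ S) := hS.prod hS
  have : CompactSpace ↥(S ×ˢ S) := isCompact_iff_compactSpace.1 hSS
  have hmeas : MeasurableSet (S ×ˢ S) := hSS.measurableSet
  let ν : Measure ↥(S ×ˢ S) := Measure.comap Subtype.val volume
  have hνuniv : ν Set.univ = volume S ^ 2 := by
    rw [comap_subtype_coe_apply hmeas, Set.image_univ, Subtype.range_coe, Measure.volume_eq_prod,
      Measure.prod_prod, sq]
  have : IsFiniteMeasure ν := ⟨by
    rw [hνuniv]; exact ENNReal.pow_lt_top hS.measure_lt_top⟩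
  let T : C(↥(S ×ˢ S), ℝ) →L[ℝ] Lp ℝ (ENNReal.ofReal r) ν := ContinuousMap.toLp _ ν ℝ
  have hcont := continuous_cosFeature S
  have hV : ∀ ω, ‖T (cosFeature S ω)‖ ≤ volume.real S ^ (2 / r) := fun ω => by
    refine (T.le_opNorm_of_le (norm_cosFeature_le ω)).trans ?_
    rw [mul_one]
    refine (ContinuousMap.toLp_norm_le ν).trans_eq ?_
    rw [ENNReal.toReal_ofReal hr0.le]
    have : ((measureUnivNNReal ν : NNReal) : ℝ) = volume.real S ^ (2 : ℝ) := by
      rw [measureUnivNNReal, ENNReal.coe_toNNReal_eq_toReal, hνuniv, ENNReal.toReal_pow,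
        Real.rpow_two, measureReal_def]
    rw [this, ← Real.rpow_mul measureReal_nonneg, div_eq_mul_inv]
  have hmain := one_sub_exp_neg_le_measureReal_norm_empirical_le (μ := Λ)
    (lt_min two_pos hr0) hC0 (hC _ ν)
    (T.continuous.comp hcont).stronglyMeasurable hV hm hτ
  have hexp : 1 / min 2 r = max (1 / 2) (1 / r) := by
    rcases le_total r 2 with h | h
    · rw [min_eq_right h, max_eq_right (one_div_le_one_div_of_le hr0 h)]
    · rw [min_eq_left h, max_eq_left (one_div_le_one_div_of_le two_pos h)]
  rw [hexp] at hmain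
  refine hmain.trans (measureReal_mono fun ω hω => ?_)
  have hint : Integrable (cosFeature S) Λ :=
    .of_bound hcont.stronglyMeasurable.aestronglyMeasurable 1 (ae_of_all _ norm_cosFeature_le)
  have hT : (∫ x, T (cosFeature S x) ∂Λ) - (1 / (m : ℝ)) • ∑ j, T (cosFeature S (ω j))
      = T ((∫ x, cosFeature S x ∂Λ) - (1 / (m : ℝ)) • ∑ j, cosFeature S (ω j)) := by
    rw [T.integral_comp_comm hint, map_sub, map_smul, map_sum]
  have heval : ∀ p : ↥(S ×ˢ S), ((∫ x, cosFeature S x ∂Λ)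
      - (1 / (m : ℝ)) • ∑ j, cosFeature S (ω j)) p
      = k p.1.1 p.1.2 - rffKernel ω p.1.1 p.1.2 := fun p => by
    have h := (ContinuousMap.evalCLM ℝ p).integral_comp_comm hint
    simp only [ContinuousMap.evalCLM_apply] at h
    rw [ContinuousMap.sub_apply, ← h, hk]
    simp [rffKernel, cosFeature]
  simp only [Set.mem_ofPred_eq, Function.comp_apply] at hω ⊢
  rw [hT] at hω
  rw [← map_comap_subtype_coe hmeas, (MeasurableEmbedding.subtype_coe hmeas).eLpNorm_map_measure]
  refine le_trans (le_of_eq ?_) (ENNReal.ofReal_le_ofReal hω)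
  rw [Lp.norm_def, ENNReal.ofReal_toReal (Lp.eLpNorm_ne_top _)]
  refine eLpNorm_congr_ae ?_
  filter_upwards [ContinuousMap.coeFn_toLp (p := ENNReal.ofReal r) (𝕜 := ℝ) ν
    ((∫ x, cosFeature S x ∂Λ) - (1 / (m : ℝ)) • ∑ j, cosFeature S (ω j))] with p hp
  rw [hp, heval]
  rfl
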